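/- Let $1\le N<K$ be integers. A transmitter with $N$ antennas serves $K$ single-antenna users. The channel vectors $\mathbf h_1,\dots,\mathbf h_K\in\mathbb C^N$ have i.i.d. $\mathcal{CN}(0,1)$ entries, $0<v_k\le 1$ are the large-scale coefficients, $\mathbf p_c$ is a (random) common precoder with $\|\mathbf p_c\|=1$, and the private precoders are the MRT precoders $\mathbf p_k=\mathbf h_k/\|\mathbf h_k\|$. For total power $P>0$, and a fraction $t\in(0,1]$ of it shared equally among the private streams, the ergodic rate of the common stream is $$R_c^{\mathrm{MRT}}(t)=\mathbb E\Big[\log_2\Big(1+\min_{1\le k\le K}\frac{P(1-t)v_kA_k}{1+\frac{Pt}{K}v_k\sum_{j=1}^K B_{k,j}}\Big)\Big],\qquad A_k=|\mathbf h_k^H\mathbf p_c|^2,\quad B_{k,j}=|\mathbf h_k^H\mathbf p_j|^2 .$$ Let $\widetilde R_c^{\mathrm{MRT}}(t)$ be the approximation of $R_c^{\mathrm{MRT}}(t)$ given by the same expectation when all the gains $A_k$, $B_{k,j}$ ($1\le j,k\le K$) are replaced by mutually independent random variables $\widetilde A_k$, $\widetilde B_{k,j}$, where $\widetilde B_{k,j}$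 has the law of $B_{k,j}$ and $\widetilde A_k$ has the law that $|\mathbf h_k^H\mathbf p_c|^2$ would have if $\mathbf p_c$ were independent of $\mathbf h_k$ (with the same marginal laws of $\mathbf h_k$ and $\mathbf p_c$). Put $$\rho^{\mathrm{MRT}}=\frac{K}{(N+K-1)K-1}\exp\Big(-\gamma-\frac1{2((N+K-1)K-1)}\Big),$$ where $\gamma$ is the Euler–Mascheroni constant. Then for $Pt\to\infty$ $$\widetilde R_c^{\mathrm{MRT}}(t)\ \ge\ \log_2\Big(1-\rho^{\mathrm{MRT}}+\frac{\rho^{\mathrm{MRT}}}{t}\Big);$$ that is, there is $s_0>0$ such that for all $P$ and all $t\in(0,1]$ with $Pt\ge s_0$ the expectation defining $\widetilde R_c^{\mathrm{MRT}}(t)$ is finite and this inequality holds. -/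

import Mathlib

open MeasureTheory ProbabilityTheory

noncomputable section

/-- The circularly symmetric complex Gaussian law `CN(0,1)`: real and imaginary parts are
independent, centred, each of variance `1/2`. -/
def stdComplexGaussian : Measure ℂ :=
  ((gaussianReal 0 (1 / 2)).prod (gaussianReal 0 (1 / 2))).map
    (fun p : ℝ × ℝ => (⟨p.1, p.2⟩ : ℂ))

/-- Rayleigh fading: the entries of the channel vectors `h k : Ω → ℂᴺ`, `k = 1, …, K`, are
jointly independent, each with law `CN(0,1)`. -/
structure IsRayleighChannel {N K : ℕ} {Ω : Type*} [MeasurableSpace Ω] (μ : Measure Ω)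
    (h : Fin K → Ω → EuclideanSpace ℂ (Fin N)) : Prop where
  hasLaw_entry : ∀ (k : Fin K) (i : Fin N),
    HasLaw (fun ω => h k ω i) stdComplexGaussian μ
  indep_entries : iIndepFun (fun (q : Fin K × Fin N) ω => h q.1 ω q.2) μ

/-- The gain `|xᴴ p|²` of the channel vector `x` along the precoder `p`. -/
def channelGain {N : ℕ} (x p : EuclideanSpace ℂ (Fin N)) : ℝ :=
  ‖inner ℂ x p‖ ^ 2

/-- The maximum ratio transmission precoder `x / |x|` of the channel vector `x`. -/
def mrtPrecoder {N : ℕ} (x : EuclideanSpace ℂ (Fin N)) : EuclideanSpace ℂ (Fin N) :=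
  ((‖x‖⁻¹ : ℝ) : ℂ) • x

/-- The SINR of the common stream at user `k`, when the common stream has gains `a k`, the
private stream of user `j` has gain `b k j` at user `k`, and the power `P * t` is shared equally
among the `K` private streams. -/
def commonSINR {K : ℕ} (v : Fin K → ℝ) (P t : ℝ) (a : Fin K → ℝ) (b : Fin K → Fin K → ℝ)
    (k : Fin K) : ℝ :=
  P * (1 - t) * v k * a k / (1 + P * t / K * v k * ∑ j, b k j)

/-- The rate of the common stream for given gains; every user has to decode the stream. -/
def commonRateOfGains {K : ℕ} (v : Fin K → ℝ) (P t : ℝ)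
    (g : (Fin K → ℝ) × (Fin K → Fin K → ℝ)) : ℝ :=
  Real.logb 2 (1 + ⨅ k, commonSINR v P t g.1 g.2 k)

section Rates

variable {N K : ℕ} {Ω : Type*} [MeasurableSpace Ω] (μ : Measure Ω)
  (h : Fin K → Ω → EuclideanSpace ℂ (Fin N)) (pc : Ω → EuclideanSpace ℂ (Fin N))

/-- The exact joint law of the gains `|h_kᴴ p_c|²` and `|h_kᴴ p_j|²`, with MRT private
precoders `p_j = h_j / |h_j|`. -/
def mrtGainLaw : Measure ((Fin K → ℝ) × (Fin K → Fin K → ℝ)) :=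
  μ.map (fun ω => (fun k => channelGain (h k ω) (pc ω),
    fun k j => channelGain (h k ω) (mrtPrecoder (h j ω))))

/-- The law of the gain of the common stream at user `k` when the common precoder is treated as
independent of the channel of user `k`. -/
def decoupledCommonGainLaw (k : Fin K) : Measure ℝ :=
  ((μ.map (h k)).prod (μ.map pc)).map (fun z => channelGain z.1 z.2)

/-- The law of the gain `|h_kᴴ p_j|²` of the MRT private stream of user `j` at user `k`. -/
def mrtPrivateGainLaw (k j : Fin K) : Measure ℝ :=
  μ.map (fun ω => channelGain (h k ω) (mrtPrecoder (h j ω)))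

/-- The approximate joint law of the gains: the common precoder is treated as independent of the
channels, and all the gains are treated as mutually independent, each private gain with its
exact law. -/
def decoupledMrtGainLaw : Measure ((Fin K → ℝ) × (Fin K → Fin K → ℝ)) :=
  (Measure.pi fun k => decoupledCommonGainLaw μ h pc k).prod
    (Measure.pi fun k => Measure.pi fun j => mrtPrivateGainLaw μ h k j)

/-- The ergodic rate of the common stream with MRT private precoders. -/
def mrtCommonRate (v : Fin K → ℝ) (P t : ℝ) : ℝ :=
  ∫ g, commonRateOfGains v P t g ∂(mrtGainLaw μ h pc)

/-- The approximation of `mrtCommonRate`: the same expectation under the decoupled law of the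
gains. -/
def approxMrtCommonRate (v : Fin K → ℝ) (P t : ℝ) : ℝ :=
  ∫ g, commonRateOfGains v P t g ∂(decoupledMrtGainLaw μ h pc)

end Rates

/-- `ρ = K / ((N + K - 1) K - 1) * exp (-γ - 1 / (2 ((N + K - 1) K - 1)))`. -/
def rhoMrt (N K : ℕ) : ℝ :=
  (K : ℝ) / (((N : ℝ) + K - 1) * K - 1) *
    Real.exp (-Real.eulerMascheroniConstant - 1 / (2 * (((N : ℝ) + K - 1) * K - 1)))

end

/-! Under the decoupled law the common gains and the cross gains are `Exp(1)`, and the own private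
gain `‖h_k‖²` is a sum of `N` independent `Exp(1)` variables. So the private gain `B_{k,j}` has
Laplace transform `(1 + y)⁻¹ ^ m`, with `m = N` if `j = k` and `m = 1` otherwise. Let `Z = min_k A_k
/ ∑_j B_{k,j}`. Conditioning on the private gains, `P(Z ≥ y) = E exp(-y ∑ B_{k,j}) = (1 + y)⁻¹ ^ (n
+ 1)` with `n + 1 = (N + K - 1) K`. Hence `(1 + Z)⁻¹` has distribution function `u ^ (n + 1)` on
`(0, 1]`, and `E log Z = -H_n`.

As `P` grows, the smallest SINR approaches `(1 - t) / t * K Z`. Since `x ↦ log (1 + r e^x)` is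
convex, Jensen's inequality suggests the bound with `K Z` replaced by `K e^{-H_n}`. The estimate
`H_n < log n + γ + 1 / (2 n)` says precisely that `ρ < K e^{-H_n}`, and its strictness leaves a gap
`δ = log K - H_n - log ρ > 0` to pay for finite power. The noise lowers the logarithm of the SINR by
at most `W / (P t)`, where `W = ∑_k K / (v_k ∑_j B_{k,j})` is integrable because `N + K - 1 ≥ 2`.

The tangent is taken at `log ρ`, not at the mean. Gap and noise loss are then multiplied by the same
slope, the only place where `t` enters apart from `P t`, so `P t ≥ E W / δ` suffices uniformly in
`t`. -/

/-! ### Harmonic numbers: an upper bound and a logarithmic integral. -/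

theorem Real.log_lt_half_sub_inv {q : ℝ} (hq : 1 < q) : Real.log q < (q - q⁻¹) / 2 := by
  rw [← Real.sinh_log (by linarith)]
  exact Real.self_lt_sinh_iff.2 (Real.log_pos hq)

/-- The sequence `H_n - log n - 1 / (2 n)` tends to `γ` and is strictly increasing: its increments
are positive by `log q < (q - q⁻¹) / 2` at `q = (n + 1) / n`. -/
theorem harmonic_lt_log_add_eulerMascheroniConstant {n : ℕ} (hn : 1 ≤ n) :
    (harmonic n : ℝ) < Real.log n + Real.eulerMascheroniConstant + 1 / (2 * n) := by
  set f : ℕ → ℝ := fun m => harmonic (m + 1) - Real.log ((m + 1 : ℕ) : ℝ)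
    - 1 / (2 * ((m + 1 : ℕ) : ℝ)) with hf
  have hstep : ∀ m, f m < f (m + 1) := by
    intro m
    have hm : (0 : ℝ) < (m : ℝ) + 1 := by positivity
    have hq : (1 : ℝ) < ((m : ℝ) + 2) / (m + 1) := by
      rw [lt_div_iff₀ hm]; linarith
    have hlog := Real.log_lt_half_sub_inv hq
    rw [Real.log_div (by positivity) hm.ne'] at hlog
    have hid : ((((m : ℝ) + 2) / (m + 1)) - (((m : ℝ) + 2) / (m + 1))⁻¹) / 2
        = 1 / (m + 2) - 1 / (2 * (m + 2)) + 1 / (2 * (m + 1)) := by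
      field_simp
      ring
    simp only [hf]
    rw [harmonic_succ (m + 1)]
    push_cast
    have e : (m : ℝ) + 1 + 1 = m + 2 := by ring
    rw [e, ← one_div]
    rw [hid] at hlog
    linarith
  have hmono : Monotone f := monotone_nat_of_le_succ fun m => (hstep m).le
  have hlim : Filter.Tendsto f Filter.atTop (nhds Real.eulerMascheroniConstant) := by
    have h1 := (Real.tendsto_harmonic_sub_log).comp (Filter.tendsto_add_atTop_nat 1)
    have h2 : Filter.Tendsto (fun m : ℕ => 1 / (2 * ((m + 1 : ℕ) : ℝ))) Filter.atTop (nhds 0) := by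
      have := (tendsto_one_div_add_atTop_nhds_zero_nat (𝕜 := ℝ)).const_mul (1 / 2)
      simp only [mul_zero] at this
      refine this.congr fun m => ?_
      push_cast
      field_simp
    have h3 : Filter.Tendsto f Filter.atTop (nhds (Real.eulerMascheroniConstant - 0)) := h1.sub h2
    rwa [sub_zero] at h3
  obtain ⟨m, rfl⟩ : ∃ m, n = m + 1 := ⟨n - 1, by omega⟩
  have h1 := (hstep m).trans_le (hmono.ge_of_tendsto hlim (m + 1))
  simp only [hf] at h1
  linarith

theorem intervalIntegrable_pow_mul_log_one_sub_sub_log (n : ℕ) :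
    IntervalIntegrable (fun u : ℝ => ((n : ℝ) + 1) * u ^ n * (Real.log (1 - u) - Real.log u))
      volume 0 1 := by
  have h1 : IntervalIntegrable (fun u : ℝ => Real.log (1 - u)) volume 0 1 := by
    have : IntervalIntegrable Real.log volume (1 - 0) (1 - 1) :=
      intervalIntegral.intervalIntegrable_log'
    simpa using this.comp_sub_left 1
  exact (h1.sub intervalIntegral.intervalIntegrable_log').continuousOn_mul (by fun_prop)

theorem integral_pow_mul_log_one_sub_sub_log (n : ℕ) :
    ∫ u in (0 : ℝ)..1, ((n : ℝ) + 1) * u ^ n * (Real.log (1 - u) - Real.log u)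
      = -(harmonic n : ℝ) := by
  -- An antiderivative, with the logarithms grouped into the form `x log x` so that it is visibly
  -- continuous at both endpoints, where the integrand may be singular.
  set F : ℝ → ℝ := fun u =>
    -(∑ j ∈ Finset.range (n + 1), u ^ j) * ((1 - u) * Real.log (1 - u))
      - (∑ j ∈ Finset.range (n + 1), u ^ (j + 1) / ((j : ℝ) + 1))
      - u ^ n * (u * Real.log u) + u ^ (n + 1) / ((n : ℝ) + 1) with hF
  have hcont : Continuous F := by
    have h1 : Continuous fun u : ℝ => (1 - u) * Real.log (1 - u) :=
      Real.continuous_mul_log.comp (by fun_prop : Continuous fun u : ℝ => 1 - u)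
    have h2 := Real.continuous_mul_log
    fun_prop
  have hgeom : ∀ u : ℝ, (∑ j ∈ Finset.range (n + 1), u ^ j) * (1 - u) = 1 - u ^ (n + 1) :=
    fun u => by have := geom_sum_mul u (n + 1); linarith
  have hderiv : ∀ u ∈ Set.Ioo (0 : ℝ) 1,
      HasDerivAt F (((n : ℝ) + 1) * u ^ n * (Real.log (1 - u) - Real.log u)) u := by
    rintro u ⟨hu0, hu1⟩
    have hF' : F = fun u : ℝ => (u ^ (n + 1) - 1) * Real.log (1 - u)
      - (∑ j ∈ Finset.range (n + 1), u ^ (j + 1) / ((j : ℝ) + 1))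
      - u ^ (n + 1) * Real.log u + u ^ (n + 1) / ((n : ℝ) + 1) := by
      funext x
      have := hgeom x
      simp only [hF]
      linear_combination (-Real.log (1 - x)) * this
    rw [hF']
    have hpow : HasDerivAt (fun u : ℝ => u ^ (n + 1)) (((n : ℝ) + 1) * u ^ n) u := by
      simpa using hasDerivAt_pow (n + 1) u
    have hlog1 : HasDerivAt (fun u : ℝ => Real.log (1 - u)) (-1 / (1 - u)) u :=
      ((hasDerivAt_id u).const_sub 1).log (by simp; linarith)
    have hlog := Real.hasDerivAt_log hu0.ne'
    have hsum : HasDerivAt (fun u : ℝ => ∑ j ∈ Finset.range (n + 1), u ^ (j + 1) / ((j : ℝ) + 1))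
        (∑ j ∈ Finset.range (n + 1), u ^ j) u := by
      refine HasDerivAt.fun_sum fun j _ => ?_
      have := (hasDerivAt_pow (j + 1) u).div_const ((j : ℝ) + 1)
      convert! this using 1
      push_cast
      field_simp
    have h := ((((hpow.sub_const 1).mul hlog1).sub hsum).sub (hpow.mul hlog)).add
      (hpow.div_const ((n : ℝ) + 1))
    convert! h using 1
    have h1u : (1 - u) ≠ 0 := by linarith
    have hg : ∑ j ∈ Finset.range (n + 1), u ^ j = (1 - u ^ (n + 1)) / (1 - u) := by
      rw [eq_div_iff h1u, hgeom]
    rw [hg]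
    field_simp
    ring
  rw [intervalIntegral.integral_eq_sub_of_hasDerivAt_of_le zero_le_one hcont.continuousOn hderiv
    (intervalIntegrable_pow_mul_log_one_sub_sub_log n)]
  -- The middle sum gives `H_{n+1}` at `1`, and the last term of `F` removes its top summand.
  have h1 : F 1 = -(harmonic n : ℝ) := by
    simp [hF, harmonic, Finset.sum_range_succ]
  have h0 : F 0 = 0 := by
    simp [hF]
  rw [h1, h0, sub_zero]

/-! ### Convexity of the rate in the logarithm of the SINR. -/

/-- With `w = r e^y`, the ratio `(1 + r e^x) / (1 + w)` is the average of `1` and `e^{x-y}` with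
weights `1 / (1 + w)` and `w / (1 + w)`. Convexity of `exp` bounds it below by the exponential of
the averaged exponents. -/
theorem log_one_add_mul_exp_ge (r x y : ℝ) (hr : 0 ≤ r) :
    Real.log (1 + r * Real.exp y) + r * Real.exp y / (1 + r * Real.exp y) * (x - y)
      ≤ Real.log (1 + r * Real.exp x) := by
  have hw : 0 ≤ r * Real.exp y := by positivity
  set w := r * Real.exp y with hwdef
  have hx : r * Real.exp x = w * Real.exp (x - y) := by
    rw [hwdef, mul_assoc, ← Real.exp_add]; ring_nf
  have hconv := convexOn_exp.2 (Set.mem_univ 0) (Set.mem_univ (x - y))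
    (show 0 ≤ 1 / (1 + w) by positivity) (show 0 ≤ w / (1 + w) by positivity) (by field_simp)
  simp only [smul_eq_mul, mul_zero, zero_add, Real.exp_zero, mul_one] at hconv
  have h2 : (1 + w) * Real.exp (w / (1 + w) * (x - y)) ≤ 1 + r * Real.exp x := by
    rw [hx]
    calc _ ≤ (1 + w) * (1 / (1 + w) + w / (1 + w) * Real.exp (x - y)) := by gcongr
      _ = _ := by field_simp
  have h3 := Real.log_le_log (by positivity) h2
  rwa [Real.log_mul (by positivity) (by positivity), Real.log_exp] at h3

/-! ### The exponential law of rate one. -/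

theorem measurable_exponentialPDF (r : ℝ) : Measurable (exponentialPDF r) :=
  (measurable_exponentialPDFReal r).ennreal_ofReal

theorem integral_expMeasure_one {E : Type*} [NormedAddCommGroup E] [NormedSpace ℝ E]
    (f : ℝ → E) :
    ∫ x, f x ∂(expMeasure 1) = ∫ x in Set.Ioi (0 : ℝ), Real.exp (-x) • f x := by
  rw [show expMeasure 1 = volume.withDensity (exponentialPDF 1) from rfl,
    integral_withDensity_eq_integral_toReal_smul
      (measurable_exponentialPDF 1)
      (Filter.Eventually.of_forall fun _ => ENNReal.ofReal_lt_top),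
    ← integral_Ici_eq_integral_Ioi, ← integral_indicator measurableSet_Ici]
  congr 1
  ext x
  by_cases hx : 0 ≤ x
  · simp [exponentialPDF_of_nonneg hx, hx, (Real.exp_pos _).le]
  · simp [exponentialPDF_of_neg (not_le.1 hx), hx]

theorem integrable_expMeasure_one_iff {f : ℝ → ℝ} :
    Integrable f (expMeasure 1) ↔
      IntegrableOn (fun x => Real.exp (-x) * f x) (Set.Ioi (0 : ℝ)) := by
  rw [show expMeasure 1 = volume.withDensity (exponentialPDF 1) from rfl,
    integrable_withDensity_iff_integrable_smul'
      (measurable_exponentialPDF 1)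
      (Filter.Eventually.of_forall fun _ => ENNReal.ofReal_lt_top),
    ← integrableOn_Ici_iff_integrableOn_Ioi, ← integrable_indicator_iff measurableSet_Ici]
  refine integrable_congr (Filter.Eventually.of_forall fun x => ?_)
  by_cases hx : 0 ≤ x
  · simp [exponentialPDF_of_nonneg hx, hx, (Real.exp_pos _).le]
  · simp [exponentialPDF_of_neg (not_le.1 hx), hx]

theorem integrable_id_expMeasure_one : Integrable (fun x : ℝ => x) (expMeasure 1) := by
  rw [integrable_expMeasure_one_iff]
  refine (Real.GammaIntegral_convergent (s := 2) two_pos).congr_fun (fun x _ => ?_)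
    measurableSet_Ioi
  norm_num

theorem expMeasure_one_Ici {x : ℝ} (hx : 0 ≤ x) :
    expMeasure 1 (Set.Ici x) = ENNReal.ofReal (Real.exp (-x)) := by
  rw [show expMeasure 1 = volume.withDensity (exponentialPDF 1) from rfl,
    withDensity_apply _ measurableSet_Ici,
    setLIntegral_congr_fun (g := fun y => ENNReal.ofReal (Real.exp (-y))) measurableSet_Ici
      (fun y hy => by simp [exponentialPDF_of_nonneg (hx.trans hy)]),
    setLIntegral_congr Ioi_ae_eq_Ici.symm,
    ← ofReal_integral_eq_lintegral_ofReal (integrableOn_exp_neg_Ioi x)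
      (Filter.Eventually.of_forall fun _ => (Real.exp_pos _).le), integral_exp_neg_Ioi]

theorem ae_pos_expMeasure_one : ∀ᵐ x ∂(expMeasure 1), 0 < x := by
  rw [show expMeasure 1 = volume.withDensity (exponentialPDF 1) from rfl,
    ae_withDensity_iff (measurable_exponentialPDF 1)]
  filter_upwards [Measure.ae_ne volume (0 : ℝ)] with x hx hpdf
  by_contra h
  exact hpdf (exponentialPDF_of_neg (lt_of_le_of_ne (not_lt.1 h) hx))

theorem integral_exp_neg_mul_expMeasure_one {y : ℝ} (hy : 0 ≤ y) :
    ∫ x, Real.exp (-(y * x)) ∂(expMeasure 1) = (1 + y)⁻¹ := by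
  rw [integral_expMeasure_one]
  simp_rw [smul_eq_mul, ← Real.exp_add]
  have := integral_exp_mul_Ioi (a := -(1 + y)) (by linarith) 0
  rw [mul_zero, Real.exp_zero] at this
  rw [← one_div, ← neg_div_neg_eq, ← this]
  congr 1 with x
  ring_nf

theorem charFun_expMeasure_one (t : ℝ) :
    charFun (expMeasure 1) t = (1 - t * Complex.I)⁻¹ := by
  rw [charFun_apply_real, integral_expMeasure_one]
  have := integral_exp_mul_complex_Ioi (a := -(1 - t * Complex.I)) (by simp) 0
  simp only [Complex.ofReal_zero, mul_zero, Complex.exp_zero] at this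
  rw [← one_div, ← neg_div_neg_eq, ← this]
  congr 1 with x
  rw [Complex.real_smul, Complex.ofReal_exp, ← Complex.exp_add]
  push_cast
  ring_nf

/-! ### The complex Gaussian law. -/

/-- The square is what the two independent coordinates of a complex Gaussian contribute to `|z|²`;
it also removes the branch of the square root. -/
theorem integral_cexp_sq_gaussianReal_half (t : ℝ) :
    (∫ x, Complex.exp (t * (x : ℂ) ^ 2 * Complex.I) ∂(gaussianReal 0 (1 / 2))) ^ 2
      = (1 - t * Complex.I)⁻¹ := by
  rw [integral_gaussianReal_eq_integral_smul (by norm_num)]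
  have hre : 0 < (1 - t * Complex.I).re := by simp
  have h : ∀ x : ℝ, gaussianPDFReal 0 (1 / 2) x • Complex.exp (t * (x : ℂ) ^ 2 * Complex.I)
      = ((√Real.pi)⁻¹ : ℝ) * Complex.exp (-(1 - t * Complex.I) * (x : ℂ) ^ 2) := by
    intro x
    rw [gaussianPDFReal_def, Complex.real_smul]
    rw [Complex.ofReal_mul, Complex.ofReal_exp, mul_assoc, ← Complex.exp_add]
    congr 2
    · rw [show (2 * Real.pi * ((1 / 2 : NNReal) : ℝ)) = Real.pi by push_cast; ring]
    · norm_num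
      ring
  simp_rw [h]
  rw [integral_const_mul, integral_gaussian_complex hre, mul_pow, ← Complex.cpow_nat_mul]
  have hs : ((((√Real.pi)⁻¹ : ℝ)) : ℂ) ^ 2 = (Real.pi : ℂ)⁻¹ := by
    rw [← Complex.ofReal_pow, inv_pow, Real.sq_sqrt Real.pi_pos.le]
    simp
  rw [hs]
  have hpi : (Real.pi : ℂ) ≠ 0 := by exact_mod_cast Real.pi_ne_zero
  norm_num
  field_simp

theorem measurable_complex_mk : Measurable (fun p : ℝ × ℝ => (⟨p.1, p.2⟩ : ℂ)) :=
  Complex.measurableEquivRealProd.symm.measurable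

instance : IsProbabilityMeasure stdComplexGaussian :=
  Measure.isProbabilityMeasure_map measurable_complex_mk.aemeasurable

theorem map_norm_sq_stdComplexGaussian :
    stdComplexGaussian.map (fun z => ‖z‖ ^ 2) = expMeasure 1 := by
  have := isProbabilityMeasure_expMeasure (r := 1) one_pos
  have hp : IsProbabilityMeasure (stdComplexGaussian.map (fun z => ‖z‖ ^ 2)) :=
    Measure.isProbabilityMeasure_map (by fun_prop)
  refine Measure.ext_of_charFun ?_
  ext t
  rw [charFun_expMeasure_one, charFun_apply_real, integral_map (by fun_prop) (by fun_prop),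
    stdComplexGaussian, integral_map measurable_complex_mk.aemeasurable (by fun_prop),
    ← integral_cexp_sq_gaussianReal_half, sq, ← integral_prod_mul]
  congr 1 with p
  rw [← Complex.exp_add, Complex.sq_norm, Complex.normSq_mk]
  push_cast
  ring_nf

theorem charFun_stdComplexGaussian (w : ℂ) :
    charFun stdComplexGaussian w = Complex.exp (-(‖w‖ ^ 2 : ℝ) / 4) := by
  have h1 := charFun_gaussianReal (μ := 0) (v := 1 / 2) w.re
  have h2 := charFun_gaussianReal (μ := 0) (v := 1 / 2) w.im
  rw [charFun_apply_real] at h1 h2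
  rw [charFun_apply, stdComplexGaussian, integral_map measurable_complex_mk.aemeasurable (by fun_prop),
    Complex.sq_norm, Complex.normSq_apply]
  calc _ = ∫ p : ℝ × ℝ, Complex.exp (w.re * p.1 * Complex.I) * Complex.exp (w.im * p.2 * Complex.I)
        ∂((gaussianReal 0 (1 / 2)).prod (gaussianReal 0 (1 / 2))) := by
        congr 1 with p
        rw [← Complex.exp_add, Complex.inner]
        simp
        ring_nf
    _ = _ := by
        rw [integral_prod_mul (fun x : ℝ => Complex.exp (w.re * x * Complex.I))
          (fun x : ℝ => Complex.exp (w.im * x * Complex.I)), h1, h2, ← Complex.exp_add]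
        congr 1
        push_cast
        ring

/-! ### Channel gains and MRT precoders. -/

theorem measurable_channelGain {N : ℕ} :
    Measurable (fun z : EuclideanSpace ℂ (Fin N) × EuclideanSpace ℂ (Fin N) =>
      channelGain z.1 z.2) := by
  unfold channelGain
  exact (continuous_inner.norm.pow 2).measurable

theorem measurable_channelGain_left {N : ℕ} (p : EuclideanSpace ℂ (Fin N)) :
    Measurable (fun x => channelGain x p) := by
  unfold channelGain
  fun_prop

theorem measurable_mrtPrecoder {N : ℕ} :
    Measurable (mrtPrecoder : EuclideanSpace ℂ (Fin N) → _) := by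
  unfold mrtPrecoder
  fun_prop

theorem channelGain_mrtPrecoder_self {N : ℕ} (x : EuclideanSpace ℂ (Fin N)) :
    channelGain x (mrtPrecoder x) = ‖x‖ ^ 2 := by
  rw [channelGain, mrtPrecoder, inner_smul_right, norm_mul, inner_self_eq_norm_sq_to_K]
  by_cases hx : ‖x‖ = 0
  · simp [hx]
  · simp
    field_simp

theorem norm_mrtPrecoder {N : ℕ} {x : EuclideanSpace ℂ (Fin N)} (hx : x ≠ 0) :
    ‖mrtPrecoder x‖ = 1 := by
  rw [mrtPrecoder, norm_smul]
  simp [norm_ne_zero_iff.2 hx]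

/-- Conditioning on the precoder: every unit vector gives the same law, so mixing over them changes
nothing. -/
theorem map_channelGain_prod {N : ℕ} {γ ν : Measure (EuclideanSpace ℂ (Fin N))}
    [IsProbabilityMeasure γ] [IsProbabilityMeasure ν] {η : Measure ℝ}
    (hγ : ∀ p, ‖p‖ = 1 → γ.map (fun x => channelGain x p) = η) (hν : ∀ᵐ p ∂ν, ‖p‖ = 1) :
    (γ.prod ν).map (fun z => channelGain z.1 z.2) = η := by
  ext s hs
  rw [Measure.map_apply measurable_channelGain hs,
    Measure.prod_apply_symm (measurable_channelGain hs)]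
  have : ∀ᵐ p ∂ν, γ ((fun x => (x, p)) ⁻¹'
      ((fun z : EuclideanSpace ℂ (Fin N) × EuclideanSpace ℂ (Fin N) =>
        channelGain z.1 z.2) ⁻¹' s)) = η s := by
    filter_upwards [hν] with p hp
    rw [← hγ p hp, Measure.map_apply (measurable_channelGain_left p) hs]
    rfl
  rw [lintegral_congr_ae this]
  simp

/-! ### Laws of the gains under Rayleigh fading. -/

namespace IsRayleighChannel

variable {N K : ℕ} {Ω : Type*} [MeasurableSpace Ω] {μ : Measure Ω}
  {h : Fin K → Ω → EuclideanSpace ℂ (Fin N)}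

theorem aemeasurable_entry (hh : IsRayleighChannel μ h) (k : Fin K) (i : Fin N) :
    AEMeasurable (fun ω => h k ω i) μ :=
  (hh.hasLaw_entry k i).aemeasurable

theorem aemeasurable_channel (hh : IsRayleighChannel μ h) (k : Fin K) : AEMeasurable (h k) μ := by
  have h1 : AEMeasurable (fun ω => (fun i => h k ω i)) μ :=
    aemeasurable_pi_lambda _ fun i => hh.aemeasurable_entry k i
  exact (WithLp.measurable_toLp 2 (Fin N → ℂ)).comp_aemeasurable h1

theorem iIndepFun_channel (hh : IsRayleighChannel μ h) (k : Fin K) :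
    iIndepFun (fun i ω => h k ω i) μ :=
  hh.indep_entries.precomp (g := fun i => (k, i)) (fun i j hij => by simpa using hij)

/-- The characteristic function of the sum is the product of Gaussian factors whose variances are
weighted by `‖p i‖²`, and these weights sum to one. -/
theorem map_inner (hh : IsRayleighChannel μ h) (k : Fin K) {p : EuclideanSpace ℂ (Fin N)}
    (hp : ‖p‖ = 1) : μ.map (fun ω => inner ℂ (h k ω) p) = stdComplexGaussian := by
  have hind : iIndepFun (fun i ω => p i * (starRingEnd ℂ) (h k ω i)) μ :=
    (hh.iIndepFun_channel k).comp (fun i z => p i * (starRingEnd ℂ) z) (fun i => by fun_prop)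
  have hprob := hind.isProbabilityMeasure
  have hme : ∀ i, AEMeasurable (fun ω => p i * (starRingEnd ℂ) (h k ω i)) μ := fun i =>
    (by fun_prop : Measurable fun z : ℂ => p i * (starRingEnd ℂ) z).comp_aemeasurable
      (hh.aemeasurable_entry k i)
  have hchar := hind.charFun_map_fun_sum_eq_prod hme
  have heq : (fun ω => inner ℂ (h k ω) p) =
      fun ω => ∑ i, p i * (starRingEnd ℂ) (h k ω i) := by
    funext ω
    simp [PiLp.inner_apply]
  have : IsProbabilityMeasure (μ.map (fun ω => inner ℂ (h k ω) p)) :=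
    Measure.isProbabilityMeasure_map (by
      rw [heq]
      exact Finset.aemeasurable_fun_sum _ fun i _ => hme i)
  refine Measure.ext_of_charFun ?_
  rw [heq]
  refine hchar.trans ?_
  ext t
  rw [Finset.prod_apply, charFun_stdComplexGaussian]
  have hfac : ∀ i, charFun (μ.map (fun ω => p i * (starRingEnd ℂ) (h k ω i))) t
      = Complex.exp (-(‖p i‖ ^ 2 * ‖t‖ ^ 2 : ℝ) / 4) := by
    intro i
    have hc := charFun_stdComplexGaussian (p i * (starRingEnd ℂ) t)
    rw [norm_mul, RCLike.norm_conj, mul_pow] at hc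
    rw [← hc, ← (hh.hasLaw_entry k i).map_eq, charFun_apply, charFun_apply,
      integral_map (hme i) (by fun_prop), integral_map (hh.aemeasurable_entry k i) (by fun_prop)]
    congr 1 with ω
    simp only [Complex.inner, map_mul, Complex.conj_conj]
    congr 3
    rw [← Complex.conj_re]
    simp only [map_mul, Complex.conj_conj]
    ring_nf
  simp_rw [hfac]
  rw [← Complex.exp_sum, ← Finset.sum_div, Finset.sum_neg_distrib, ← Complex.ofReal_sum,
    ← Finset.sum_mul, ← EuclideanSpace.norm_sq_eq, hp, one_pow, one_mul]

theorem map_channelGain (hh : IsRayleighChannel μ h) (k : Fin K) {p : EuclideanSpace ℂ (Fin N)}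
    (hp : ‖p‖ = 1) : (μ.map (h k)).map (fun x => channelGain x p) = expMeasure 1 := by
  have hm : Measurable (fun x : EuclideanSpace ℂ (Fin N) => channelGain x p) :=
    measurable_channelGain_left _
  have hi : AEMeasurable (fun ω => inner ℂ (h k ω) p) μ := by
    have := hh.aemeasurable_channel k
    fun_prop
  rw [AEMeasurable.map_map_of_aemeasurable hm.aemeasurable (hh.aemeasurable_channel k),
    ← map_norm_sq_stdComplexGaussian, ← hh.map_inner k hp,
    AEMeasurable.map_map_of_aemeasurable (by fun_prop) hi]
  rfl

theorem decoupledCommonGainLaw_eq (hh : IsRayleighChannel μ h) [IsProbabilityMeasure μ]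
    {pc : Ω → EuclideanSpace ℂ (Fin N)} (hpc : AEMeasurable pc μ)
    (hpc_norm : ∀ᵐ ω ∂μ, ‖pc ω‖ = 1) (k : Fin K) :
    decoupledCommonGainLaw μ h pc k = expMeasure 1 := by
  have := Measure.isProbabilityMeasure_map (hh.aemeasurable_channel k)
  have := Measure.isProbabilityMeasure_map hpc
  exact map_channelGain_prod (fun p hp => hh.map_channelGain k hp)
    ((ae_map_iff hpc (measurableSet_eq_fun (by fun_prop) (by fun_prop))).2 hpc_norm)

theorem ae_ne_zero (hh : IsRayleighChannel μ h) (hN : 1 ≤ N) (k : Fin K) :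
    ∀ᵐ ω ∂μ, h k ω ≠ 0 := by
  -- The gain along one coordinate vector is exponential, hence almost surely positive, which
  -- excludes a zero channel.
  set e : EuclideanSpace ℂ (Fin N) := EuclideanSpace.single ⟨0, hN⟩ 1
  have hm : Measurable (fun x : EuclideanSpace ℂ (Fin N) => channelGain x e) :=
    measurable_channelGain_left _
  have h1 := ae_pos_expMeasure_one
  rw [← hh.map_channelGain k (p := e) (by simp [e])] at h1
  filter_upwards [ae_of_ae_map (hh.aemeasurable_channel k) (ae_of_ae_map hm.aemeasurable h1)]
    with ω hω h0
  simp [h0, channelGain] at hω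

theorem indepFun_channel (hh : IsRayleighChannel μ h) {k j : Fin K} (hkj : k ≠ j) :
    IndepFun (h k) (h j) μ := by
  classical
  set S : Fin K → Finset (Fin K × Fin N) := fun k => Finset.univ.image fun i => (k, i) with hS
  have hd : Disjoint (S k) (S j) := by
    rw [Finset.disjoint_left]
    rintro ⟨a, i⟩ h1 h2
    simp only [hS, Finset.mem_image, Finset.mem_univ, true_and, Prod.mk.injEq] at h1 h2
    obtain ⟨_, rfl, _⟩ := h1
    obtain ⟨_, h3, _⟩ := h2
    exact hkj h3.symm
  have hi := hh.indep_entries.indepFun_finset₀ (S k) (S j) hd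
    (fun q => hh.aemeasurable_entry q.1 q.2)
  have hmeas : ∀ k, Measurable (fun x : S k → ℂ => (WithLp.toLp 2 fun i : Fin N =>
      x ⟨(k, i), Finset.mem_image_of_mem _ (Finset.mem_univ i)⟩ : EuclideanSpace ℂ (Fin N))) :=
    fun k => (WithLp.measurable_toLp 2 (Fin N → ℂ)).comp
      (measurable_pi_lambda _ fun i => measurable_pi_apply _)
  exact hi.comp (hmeas k) (hmeas j)

/-- The direction of `h j` is a unit vector independent of `h k`, so the law is that of the gain
along a fixed direction. -/
theorem mrtPrivateGainLaw_eq_of_ne (hh : IsRayleighChannel μ h) [IsProbabilityMeasure μ]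
    (hN : 1 ≤ N) {k j : Fin K} (hkj : k ≠ j) :
    mrtPrivateGainLaw μ h k j = expMeasure 1 := by
  have hind : IndepFun (h k) (fun ω => mrtPrecoder (h j ω)) μ :=
    (hh.indepFun_channel hkj).comp measurable_id measurable_mrtPrecoder
  have hm : AEMeasurable (fun ω => mrtPrecoder (h j ω)) μ :=
    measurable_mrtPrecoder.comp_aemeasurable (hh.aemeasurable_channel j)
  have := Measure.isProbabilityMeasure_map (hh.aemeasurable_channel k)
  have := Measure.isProbabilityMeasure_map hm
  rw [← map_channelGain_prod (fun p hp => hh.map_channelGain k hp)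
    (ν := μ.map (fun ω => mrtPrecoder (h j ω)))
    ((ae_map_iff hm (measurableSet_eq_fun (by fun_prop) (by fun_prop))).2
      ((hh.ae_ne_zero hN j).mono fun ω hω => norm_mrtPrecoder hω)),
    ← (indepFun_iff_map_prod_eq_prod_map_map (hh.aemeasurable_channel k) hm).1 hind,
    AEMeasurable.map_map_of_aemeasurable measurable_channelGain.aemeasurable
      ((hh.aemeasurable_channel k).prodMk hm)]
  rfl

theorem aemeasurable_privateGain (hh : IsRayleighChannel μ h) (k j : Fin K) :
    AEMeasurable (fun ω => channelGain (h k ω) (mrtPrecoder (h j ω))) μ := by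
  have h1 := hh.aemeasurable_channel k
  have h2 : AEMeasurable (fun ω => mrtPrecoder (h j ω)) μ :=
    measurable_mrtPrecoder.comp_aemeasurable (hh.aemeasurable_channel j)
  unfold channelGain
  fun_prop

theorem ae_pos_mrtPrivateGainLaw (hh : IsRayleighChannel μ h) [IsProbabilityMeasure μ]
    (hN : 1 ≤ N) (k j : Fin K) : ∀ᵐ x ∂(mrtPrivateGainLaw μ h k j), 0 < x := by
  by_cases hkj : k = j
  · subst hkj
    rw [mrtPrivateGainLaw, ae_map_iff (hh.aemeasurable_privateGain k k) measurableSet_Ioi]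
    filter_upwards [hh.ae_ne_zero hN k] with ω hω
    rw [channelGain_mrtPrecoder_self]
    exact pow_pos (norm_pos_iff.2 hω) 2
  · rw [hh.mrtPrivateGainLaw_eq_of_ne hN hkj]
    exact ae_pos_expMeasure_one

theorem integral_exp_neg_mul_mrtPrivateGainLaw (hh : IsRayleighChannel μ h)
    [IsProbabilityMeasure μ] (hN : 1 ≤ N) (k j : Fin K) {y : ℝ} (hy : 0 ≤ y) :
    ∫ x, Real.exp (-(y * x)) ∂(mrtPrivateGainLaw μ h k j)
      = (1 + y)⁻¹ ^ (if j = k then N else 1) := by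
  by_cases hkj : j = k
  · subst hkj
    rw [mrtPrivateGainLaw, integral_map (hh.aemeasurable_privateGain j j) (by fun_prop), if_pos rfl]
    have hind : iIndepFun (fun i ω => ‖h j ω i‖ ^ 2) μ :=
      (hh.iIndepFun_channel j).comp (fun _ z => ‖z‖ ^ 2) (fun i => by fun_prop)
    have hm : ∀ i, AEMeasurable (fun ω => ‖h j ω i‖ ^ 2) μ := fun i => by
      have := hh.aemeasurable_entry j i
      fun_prop
    have hmgf := hind.mgf_sum₀ hm Finset.univ (t := -y)
    have hone : ∀ i, mgf (fun ω => ‖h j ω i‖ ^ 2) μ (-y) = (1 + y)⁻¹ := fun i => by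
      rw [← integral_exp_neg_mul_expMeasure_one hy, ← map_norm_sq_stdComplexGaussian,
        integral_map (by fun_prop) (by fun_prop), ← (hh.hasLaw_entry j i).map_eq,
        integral_map (hh.aemeasurable_entry j i) (by fun_prop), mgf]
      simp_rw [neg_mul]
    simp only [hone, Finset.prod_const, Finset.card_univ, Fintype.card_fin] at hmgf
    rw [← hmgf, mgf]
    congr 1 with ω
    rw [channelGain_mrtPrecoder_self, EuclideanSpace.norm_sq_eq]
    simp
  · rw [hh.mrtPrivateGainLaw_eq_of_ne hN (Ne.symm hkj), if_neg hkj, pow_one,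
      integral_exp_neg_mul_expMeasure_one hy]

end IsRayleighChannel

/-! ### Integrability of the inverse total private gain. -/

/-- Write `S⁻¹ = ∫₀^∞ e^{-yS} dy` and exchange the integrals: the Laplace transform of `S` is `(1 +
y)⁻¹` to the power `∑ m j`, integrable on the half-line once the exponent is at least two. -/
theorem integrable_inv_sum_pi {ι : Type*} [Fintype ι] [Nonempty ι] {β : ι → Measure ℝ}
    [∀ j, IsProbabilityMeasure (β j)]
    {m : ι → ℕ} (hpos : ∀ j, ∀ᵐ x ∂(β j), 0 < x)
    (hβ : ∀ j (y : ℝ), 0 ≤ y → ∫ x, Real.exp (-(y * x)) ∂(β j) = (1 + y)⁻¹ ^ m j)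
    (hm : 2 ≤ ∑ j, m j) :
    Integrable (fun b : ι → ℝ => (∑ j, b j)⁻¹) (Measure.pi β) := by
  have hpos' : ∀ᵐ b ∂(Measure.pi β), ∀ j, 0 < b j :=
    ae_all_iff.2 fun j => (Measure.tendsto_eval_ae_ae (i := j)).eventually (hpos j)
  have hlap : ∀ y : ℝ, 0 ≤ y →
      ∫ b, Real.exp (-(y * ∑ j, b j)) ∂(Measure.pi β) = (1 + y)⁻¹ ^ (∑ j, m j) := by
    intro y hy
    simp_rw [Finset.mul_sum, ← Finset.sum_neg_distrib, Real.exp_sum]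
    rw [integral_fintype_prod_eq_prod (fun (_ : ι) x => Real.exp (-(y * x)))]
    simp_rw [hβ _ y hy]
    exact Finset.prod_pow_eq_pow_sum _ _ _
  have hint : IntegrableOn (fun y : ℝ => (y + 1) ^ (-2 : ℝ)) (Set.Ioi 0) :=
    integrableOn_add_rpow_Ioi_of_lt (by norm_num) (by norm_num)
  refine ⟨by fun_prop, ?_⟩
  rw [HasFiniteIntegral]
  calc ∫⁻ b, ‖(∑ j, b j)⁻¹‖ₑ ∂(Measure.pi β)
      = ∫⁻ b, (∫⁻ y in Set.Ioi (0 : ℝ), ENNReal.ofReal (Real.exp (-(y * ∑ j, b j))))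
          ∂(Measure.pi β) := by
        refine lintegral_congr_ae ?_
        filter_upwards [hpos'] with b hb
        have hS : 0 < ∑ j, b j := Finset.sum_pos (fun j _ => hb j) Finset.univ_nonempty
        have h1 := integral_exp_mul_Ioi (a := -∑ j, b j) (by linarith) 0
        have h2 := integrableOn_exp_mul_Ioi (a := -∑ j, b j) (by linarith) 0
        simp_rw [show ∀ y : ℝ, -(y * ∑ j, b j) = (-∑ j, b j) * y from fun y => by ring]
        rw [← ofReal_integral_eq_lintegral_ofReal h2
          (Filter.Eventually.of_forall fun _ => (Real.exp_pos _).le), h1,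
          Real.enorm_of_nonneg (by positivity)]
        simp
    _ = ∫⁻ y in Set.Ioi (0 : ℝ), ∫⁻ b, ENNReal.ofReal (Real.exp (-(y * ∑ j, b j)))
          ∂(Measure.pi β) := lintegral_lintegral_swap (by fun_prop)
    _ ≤ ∫⁻ y in Set.Ioi (0 : ℝ), ENNReal.ofReal ((y + 1) ^ (-2 : ℝ)) := by
        refine setLIntegral_mono (by fun_prop) fun y hy => ?_
        have hy : 0 < y := hy
        have hle : ∀ᵐ b ∂(Measure.pi β), ‖Real.exp (-(y * ∑ j, b j))‖ ≤ 1 := by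
          filter_upwards [hpos'] with b hb
          rw [Real.norm_of_nonneg (Real.exp_pos _).le, Real.exp_le_one_iff]
          have : 0 ≤ ∑ j, b j := Finset.sum_nonneg fun j _ => (hb j).le
          nlinarith
        rw [← ofReal_integral_eq_lintegral_ofReal (Integrable.of_bound (by fun_prop) 1 hle)
          (Filter.Eventually.of_forall fun _ => (Real.exp_pos _).le), hlap y hy.le]
        refine ENNReal.ofReal_le_ofReal ?_
        refine (pow_le_pow_of_le_one (by positivity)
          (inv_le_one_of_one_le₀ (by linarith)) hm).trans_eq ?_
        rw [Real.rpow_neg (by linarith), Real.rpow_two, inv_pow, add_comm y 1]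
    _ < ⊤ := hint.lintegral_lt_top

/-! ### The law of `(1 + Z)⁻¹`. -/

/-- The law with density `(n + 1) * u ^ n` on `(0, 1]`. -/
noncomputable def powerLaw (n : ℕ) : Measure ℝ :=
  (volume.restrict (Set.Ioc (0 : ℝ) 1)).withDensity
    (fun u => ENNReal.ofReal (((n : ℝ) + 1) * u ^ n))

theorem powerLaw_Iic_of_mem {n : ℕ} {u : ℝ} (h0 : 0 ≤ u) (h1 : u ≤ 1) :
    powerLaw n (Set.Iic u) = ENNReal.ofReal (u ^ (n + 1)) := by
  have hset : Set.Iic u ∩ Set.Ioc (0 : ℝ) 1 = Set.Ioc 0 u := by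
    ext x
    simp only [Set.mem_inter_iff, Set.mem_Iic, Set.mem_Ioc]
    constructor
    · rintro ⟨h, h', -⟩; exact ⟨h', h⟩
    · rintro ⟨h, h'⟩; exact ⟨h', h, h'.trans h1⟩
  have hc : Continuous fun u : ℝ => ((n : ℝ) + 1) * u ^ n := by fun_prop
  rw [powerLaw, withDensity_apply _ measurableSet_Iic, Measure.restrict_restrict measurableSet_Iic,
    hset, ← ofReal_integral_eq_lintegral_ofReal
      ((intervalIntegrable_iff_integrableOn_Ioc_of_le h0).1 (hc.intervalIntegrable 0 u)),
    ← intervalIntegral.integral_of_le h0, intervalIntegral.integral_const_mul, integral_pow]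
  · congr 1
    simp
    field_simp
  · refine (ae_restrict_iff' measurableSet_Ioc).2 (Filter.Eventually.of_forall fun x hx => ?_)
    have := hx.1
    simp only [Pi.zero_apply]
    positivity

theorem eq_powerLaw {n : ℕ} {ν : Measure ℝ} [IsProbabilityMeasure ν]
    (hν : ∀ᵐ u ∂ν, 0 < u ∧ u ≤ 1)
    (h : ∀ u, 0 < u → u ≤ 1 → ν (Set.Iic u) = ENNReal.ofReal (u ^ (n + 1))) :
    ν = powerLaw n := by
  refine Measure.ext_of_Iic _ _ fun u => ?_
  rcases le_or_gt u 0 with h0 | h0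
  · have h1 : ν (Set.Iic u) = 0 := by
      rw [measure_eq_zero_iff_ae_notMem]
      filter_upwards [hν] with x hx hxu
      exact absurd (hx.1.trans_le hxu) (not_lt.2 h0)
    have h2 : powerLaw n (Set.Iic u) ≤ 0 := by
      calc _ ≤ powerLaw n (Set.Iic 0) := measure_mono (Set.Iic_subset_Iic.2 h0)
        _ = 0 := by rw [powerLaw_Iic_of_mem le_rfl zero_le_one]; simp
    rw [h1]
    exact (le_antisymm h2 bot_le).symm
  rcases le_or_gt u 1 with h1 | h1
  · rw [h u h0 h1, powerLaw_Iic_of_mem h0.le h1]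
  · have h2 : ν (Set.Iic u) = 1 := by
      rw [← measure_univ (μ := ν)]
      refine measure_congr ?_
      filter_upwards [hν] with x hx
      exact propext ⟨fun _ => trivial, fun _ => hx.2.trans h1.le⟩
    have h3 : powerLaw n (Set.Iic u) = powerLaw n (Set.Iic 1) := by
      have hset : Set.Iic u ∩ Set.Ioc (0 : ℝ) 1 = Set.Iic 1 ∩ Set.Ioc (0 : ℝ) 1 := by
        ext x
        simp only [Set.mem_inter_iff, Set.mem_Iic, Set.mem_Ioc]
        constructor
        · rintro ⟨_, h', h''⟩; exact ⟨h'', h', h''⟩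
        · rintro ⟨_, h', h''⟩; exact ⟨h''.trans h1.le, h', h''⟩
      rw [powerLaw, withDensity_apply _ measurableSet_Iic, withDensity_apply _ measurableSet_Iic,
        Measure.restrict_restrict measurableSet_Iic, Measure.restrict_restrict measurableSet_Iic,
        hset]
    rw [h2, h3, powerLaw_Iic_of_mem zero_le_one le_rfl]
    simp

theorem integrable_log_powerLaw (n : ℕ) :
    Integrable (fun u => Real.log (1 - u) - Real.log u) (powerLaw n) := by
  rw [powerLaw, integrable_withDensity_iff_integrable_smul' (by fun_prop)
    (Filter.Eventually.of_forall fun _ => ENNReal.ofReal_lt_top)]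
  refine (((intervalIntegrable_iff_integrableOn_Ioc_of_le zero_le_one).1
    (intervalIntegrable_pow_mul_log_one_sub_sub_log n)).congr_fun (fun u hu => ?_)
    measurableSet_Ioc)
  have := hu.1
  rw [ENNReal.toReal_ofReal (by positivity), smul_eq_mul]

theorem integral_log_powerLaw (n : ℕ) :
    ∫ u, (Real.log (1 - u) - Real.log u) ∂(powerLaw n) = -(harmonic n : ℝ) := by
  rw [powerLaw, integral_withDensity_eq_integral_toReal_smul (by fun_prop)
    (Filter.Eventually.of_forall fun _ => ENNReal.ofReal_lt_top),
    ← integral_pow_mul_log_one_sub_sub_log n, intervalIntegral.integral_of_le zero_le_one]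
  refine setIntegral_congr_fun measurableSet_Ioc fun u hu => ?_
  have := hu.1
  rw [ENNReal.toReal_ofReal (by positivity), smul_eq_mul]

/-! ### The smallest gain ratio and its expected logarithm. -/

section GainRatios

variable {ι κ : Type*} [Fintype ι] [Fintype κ] {β : ι → κ → Measure ℝ}

/-- Given the private gains, the exponential tails of the common gains multiply to `exp(-y ∑ b k
j)`. Averaging factors into Laplace transforms, so only the total exponent survives. -/
theorem gainLaw_forall_mul_sum_le [∀ k j, IsProbabilityMeasure (β k j)] {m : ι → κ → ℕ}
    (hpos : ∀ k j, ∀ᵐ x ∂(β k j), 0 < x)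
    (hβ : ∀ k j (y : ℝ), 0 ≤ y → ∫ x, Real.exp (-(y * x)) ∂(β k j) = (1 + y)⁻¹ ^ m k j)
    {y : ℝ} (hy : 0 ≤ y) :
    ((Measure.pi fun _ : ι => expMeasure 1).prod (Measure.pi fun k => Measure.pi (β k)))
      {g | ∀ k, y * ∑ j, g.2 k j ≤ g.1 k} = ENNReal.ofReal ((1 + y)⁻¹ ^ (∑ k, ∑ j, m k j)) := by
  have := isProbabilityMeasure_expMeasure (r := 1) one_pos
  have hmeas : MeasurableSet
      {g : (ι → ℝ) × (ι → κ → ℝ) | ∀ k, y * ∑ j, g.2 k j ≤ g.1 k} := by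
    rw [Set.ofPred_forall]
    exact MeasurableSet.iInter fun k => measurableSet_le (by fun_prop) (by fun_prop)
  have hpos' : ∀ᵐ b ∂(Measure.pi fun k => Measure.pi (β k)), ∀ k j, 0 < b k j :=
    ae_all_iff.2 fun k => ae_all_iff.2 fun j =>
      (Measure.tendsto_eval_ae_ae (μ := fun k => Measure.pi (β k)) (i := k)).eventually
        ((Measure.tendsto_eval_ae_ae (i := j)).eventually (hpos k j))
  rw [Measure.prod_apply_symm hmeas]
  calc _ = ∫⁻ b, ENNReal.ofReal (∏ k, ∏ j, Real.exp (-(y * b k j)))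
        ∂(Measure.pi fun k => Measure.pi (β k)) := by
        refine lintegral_congr_ae ?_
        filter_upwards [hpos'] with b hb
        have hset : (fun a : ι → ℝ => (a, b)) ⁻¹' {g | ∀ k, y * ∑ j, g.2 k j ≤ g.1 k}
            = Set.univ.pi fun k => Set.Ici (y * ∑ j, b k j) := by
          ext a
          simp only [Set.mem_preimage, Set.mem_ofPred_eq, Set.mem_univ_pi, Set.mem_Ici]
        rw [hset, Measure.pi_pi, ENNReal.ofReal_prod_of_nonneg
          (fun k _ => Finset.prod_nonneg fun j _ => (Real.exp_pos _).le)]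
        refine Finset.prod_congr rfl fun k _ => ?_
        rw [expMeasure_one_Ici (mul_nonneg hy (Finset.sum_nonneg fun j _ => (hb k j).le)),
          ← Real.exp_sum, Finset.sum_neg_distrib, Finset.mul_sum]
    _ = ENNReal.ofReal (∫ b, ∏ k, ∏ j, Real.exp (-(y * b k j))
        ∂(Measure.pi fun k => Measure.pi (β k))) := by
        have hnn : ∀ b : ι → κ → ℝ, 0 ≤ ∏ k, ∏ j, Real.exp (-(y * b k j)) := fun b =>
          Finset.prod_nonneg fun k _ => Finset.prod_nonneg fun j _ => (Real.exp_pos _).le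
        refine (ofReal_integral_eq_lintegral_ofReal (Integrable.of_bound
          (Continuous.aestronglyMeasurable (by fun_prop)) 1 ?_)
          (Filter.Eventually.of_forall hnn)).symm
        filter_upwards [hpos'] with b hb
        rw [Real.norm_of_nonneg (hnn b)]
        refine Finset.prod_le_one (fun k _ => Finset.prod_nonneg fun j _ => (Real.exp_pos _).le)
          fun k _ => Finset.prod_le_one (fun j _ => (Real.exp_pos _).le) fun j _ => ?_
        rw [Real.exp_le_one_iff, neg_nonpos]
        exact mul_nonneg hy (hb k j).le
    _ = _ := by
        rw [integral_fintype_prod_eq_prod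
          (fun (_ : ι) (x : κ → ℝ) => ∏ j, Real.exp (-(y * x j)))]
        congr 1
        rw [← Finset.prod_pow_eq_pow_sum]
        refine Finset.prod_congr rfl fun k _ => ?_
        rw [integral_fintype_prod_eq_prod (fun (_ : κ) x => Real.exp (-(y * x))),
          ← Finset.prod_pow_eq_pow_sum]
        exact Finset.prod_congr rfl fun j _ => hβ k j y hy

theorem ae_pos_gainLaw [∀ k j, IsProbabilityMeasure (β k j)]
    (hpos : ∀ k j, ∀ᵐ x ∂(β k j), 0 < x) :
    ∀ᵐ g ∂((Measure.pi fun _ : ι => expMeasure 1).prod (Measure.pi fun k => Measure.pi (β k))),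
      (∀ k, 0 < g.1 k) ∧ ∀ k j, 0 < g.2 k j := by
  have := isProbabilityMeasure_expMeasure (r := 1) one_pos
  have h1 : ∀ᵐ a ∂(Measure.pi fun _ : ι => expMeasure 1), ∀ k, 0 < a k :=
    ae_all_iff.2 fun k => (Measure.tendsto_eval_ae_ae (i := k)).eventually ae_pos_expMeasure_one
  have h2 : ∀ᵐ b ∂(Measure.pi fun k => Measure.pi (β k)), ∀ k j, 0 < b k j :=
    ae_all_iff.2 fun k => ae_all_iff.2 fun j =>
      (Measure.tendsto_eval_ae_ae (μ := fun k => Measure.pi (β k)) (i := k)).eventually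
        ((Measure.tendsto_eval_ae_ae (i := j)).eventually (hpos k j))
  exact (Measure.quasiMeasurePreserving_fst.ae h1).and (Measure.quasiMeasurePreserving_snd.ae h2)

/-- The smallest ratio between the common gain and the total private gain of a user. -/
noncomputable def minGainRatio (g : (ι → ℝ) × (ι → κ → ℝ)) : ℝ :=
  ⨅ k, g.1 k / ∑ j, g.2 k j

theorem measurable_minGainRatio :
    Measurable (minGainRatio : (ι → ℝ) × (ι → κ → ℝ) → ℝ) := by
  unfold minGainRatio
  exact Measurable.iInf fun k => by fun_prop

theorem minGainRatio_pos [Nonempty ι] [Nonempty κ] {g : (ι → ℝ) × (ι → κ → ℝ)}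
    (h1 : ∀ k, 0 < g.1 k) (h2 : ∀ k j, 0 < g.2 k j) : 0 < minGainRatio g := by
  obtain ⟨k, hk⟩ := exists_eq_ciInf_of_finite (f := fun k => g.1 k / ∑ j, g.2 k j)
  rw [minGainRatio, ← hk]
  exact div_pos (h1 k) (Finset.sum_pos (fun j _ => h2 k j) Finset.univ_nonempty)

theorem le_minGainRatio_iff [Nonempty ι] [Nonempty κ] {g : (ι → ℝ) × (ι → κ → ℝ)}
    (h2 : ∀ k j, 0 < g.2 k j) {y : ℝ} :
    y ≤ minGainRatio g ↔ ∀ k, y * ∑ j, g.2 k j ≤ g.1 k := by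
  rw [minGainRatio, le_ciInf_iff (Set.finite_range _).bddBelow]
  exact forall_congr' fun k =>
    le_div_iff₀ (Finset.sum_pos (fun j _ => h2 k j) Finset.univ_nonempty)

theorem map_inv_one_add_minGainRatio [Nonempty ι] [Nonempty κ]
    [∀ k j, IsProbabilityMeasure (β k j)] {m : ι → κ → ℕ} {n : ℕ}
    (hpos : ∀ k j, ∀ᵐ x ∂(β k j), 0 < x)
    (hβ : ∀ k j (y : ℝ), 0 ≤ y → ∫ x, Real.exp (-(y * x)) ∂(β k j) = (1 + y)⁻¹ ^ m k j)
    (hm : ∑ k, ∑ j, m k j = n + 1) :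
    ((Measure.pi fun _ : ι => expMeasure 1).prod (Measure.pi fun k => Measure.pi (β k))).map
      (fun g => (1 + minGainRatio g)⁻¹) = powerLaw n := by
  have := isProbabilityMeasure_expMeasure (r := 1) one_pos
  have hmeas : Measurable fun g : (ι → ℝ) × (ι → κ → ℝ) => (1 + minGainRatio g)⁻¹ :=
    (measurable_minGainRatio.const_add 1).inv
  have := Measure.isProbabilityMeasure_map (hmeas.aemeasurable (μ :=
    (Measure.pi fun _ : ι => expMeasure 1).prod (Measure.pi fun k => Measure.pi (β k))))
  refine eq_powerLaw ?_ fun u hu0 hu1 => ?_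
  · rw [ae_map_iff hmeas.aemeasurable measurableSet_Ioc]
    filter_upwards [ae_pos_gainLaw hpos] with g hg
    have := minGainRatio_pos hg.1 hg.2
    exact ⟨by positivity, inv_le_one_of_one_le₀ (by linarith)⟩
  -- The event `(1 + Z)⁻¹ ≤ u` is `Z ≥ u⁻¹ - 1`.
  · have hy : 0 ≤ u⁻¹ - 1 := sub_nonneg.2 (one_le_inv_iff₀.2 ⟨hu0, hu1⟩)
    rw [Measure.map_apply hmeas measurableSet_Iic]
    have h := gainLaw_forall_mul_sum_le hpos hβ hy
    rw [add_sub_cancel, inv_inv, hm] at h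
    rw [← h]
    refine measure_congr ?_
    filter_upwards [ae_pos_gainLaw hpos] with g hg
    have hZ := minGainRatio_pos hg.1 hg.2
    refine propext ?_
    change (1 + minGainRatio g)⁻¹ ≤ u ↔ ∀ k, (u⁻¹ - 1) * ∑ j, g.2 k j ≤ g.1 k
    rw [← le_minGainRatio_iff hg.2, inv_le_comm₀ (by positivity) hu0, sub_le_iff_le_add']

theorem log_minGainRatio_ae [Nonempty ι] [Nonempty κ] [∀ k j, IsProbabilityMeasure (β k j)]
    (hpos : ∀ k j, ∀ᵐ x ∂(β k j), 0 < x) :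
    (fun g => Real.log (1 - (1 + minGainRatio g)⁻¹) - Real.log (1 + minGainRatio g)⁻¹)
      =ᵐ[(Measure.pi fun _ : ι => expMeasure 1).prod (Measure.pi fun k => Measure.pi (β k))]
      fun g => Real.log (minGainRatio g) := by
  filter_upwards [ae_pos_gainLaw hpos] with g hg
  have hZ := minGainRatio_pos hg.1 hg.2
  have h1 : 1 - (1 + minGainRatio g)⁻¹ = minGainRatio g / (1 + minGainRatio g) := by
    field_simp
    ring
  rw [h1, Real.log_div hZ.ne' (by positivity), Real.log_inv]
  ring

theorem integrable_log_minGainRatio [Nonempty ι] [Nonempty κ]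
    [∀ k j, IsProbabilityMeasure (β k j)] {m : ι → κ → ℕ} {n : ℕ}
    (hpos : ∀ k j, ∀ᵐ x ∂(β k j), 0 < x)
    (hβ : ∀ k j (y : ℝ), 0 ≤ y → ∫ x, Real.exp (-(y * x)) ∂(β k j) = (1 + y)⁻¹ ^ m k j)
    (hm : ∑ k, ∑ j, m k j = n + 1) :
    Integrable (fun g => Real.log (minGainRatio g))
      ((Measure.pi fun _ : ι => expMeasure 1).prod (Measure.pi fun k => Measure.pi (β k))) := by
  have h := integrable_log_powerLaw n
  rw [← map_inv_one_add_minGainRatio hpos hβ hm] at h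
  exact (h.comp_measurable (measurable_minGainRatio.const_add 1).inv).congr
    (log_minGainRatio_ae hpos)

theorem integral_log_minGainRatio [Nonempty ι] [Nonempty κ]
    [∀ k j, IsProbabilityMeasure (β k j)] {m : ι → κ → ℕ} {n : ℕ}
    (hpos : ∀ k j, ∀ᵐ x ∂(β k j), 0 < x)
    (hβ : ∀ k j (y : ℝ), 0 ≤ y → ∫ x, Real.exp (-(y * x)) ∂(β k j) = (1 + y)⁻¹ ^ m k j)
    (hm : ∑ k, ∑ j, m k j = n + 1) :
    ∫ g, Real.log (minGainRatio g)
      ∂((Measure.pi fun _ : ι => expMeasure 1).prod (Measure.pi fun k => Measure.pi (β k)))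
      = -(harmonic n : ℝ) := by
  rw [← integral_log_powerLaw n, ← map_inv_one_add_minGainRatio hpos hβ hm,
    integral_map (φ := fun g => (1 + minGainRatio g)⁻¹)
      (measurable_minGainRatio.const_add 1).inv.aemeasurable
      (Measurable.aestronglyMeasurable (by fun_prop))]
  exact (integral_congr_ae (log_minGainRatio_ae hpos)).symm

theorem integrable_inv_sum_gainLaw [Nonempty κ] [∀ k j, IsProbabilityMeasure (β k j)]
    {m : ι → κ → ℕ} (hpos : ∀ k j, ∀ᵐ x ∂(β k j), 0 < x)
    (hβ : ∀ k j (y : ℝ), 0 ≤ y → ∫ x, Real.exp (-(y * x)) ∂(β k j) = (1 + y)⁻¹ ^ m k j)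
    {k : ι} (hm : 2 ≤ ∑ j, m k j) :
    Integrable (fun g => (∑ j, g.2 k j)⁻¹)
      ((Measure.pi fun _ : ι => expMeasure 1).prod (Measure.pi fun k => Measure.pi (β k))) := by
  have := isProbabilityMeasure_expMeasure (r := 1) one_pos
  have h := integrable_inv_sum_pi (hpos k) (hβ k) hm
  have h1 := (measurePreserving_eval (fun k => Measure.pi (β k)) k).integrable_comp_of_integrable h
  exact h1.comp_snd _

theorem integrable_commonGain_gainLaw [∀ k j, IsProbabilityMeasure (β k j)] (k : ι) :
    Integrable (fun g : (ι → ℝ) × (ι → κ → ℝ) => g.1 k)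
      ((Measure.pi fun _ : ι => expMeasure 1).prod (Measure.pi fun k => Measure.pi (β k))) := by
  have := isProbabilityMeasure_expMeasure (r := 1) one_pos
  have h1 := (measurePreserving_eval (fun _ : ι => expMeasure 1) k).integrable_comp_of_integrable
    integrable_id_expMeasure_one
  exact h1.comp_fst _

end GainRatios

/-! ### Bounds on the rate for given gains. -/

theorem measurable_commonSINR {K : ℕ} (v : Fin K → ℝ) (P t : ℝ) (k : Fin K) :
    Measurable (fun g : (Fin K → ℝ) × (Fin K → Fin K → ℝ) => commonSINR v P t g.1 g.2 k) := by
  unfold commonSINR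
  fun_prop

theorem measurable_commonRateOfGains {K : ℕ} (v : Fin K → ℝ) (P t : ℝ) :
    Measurable (commonRateOfGains v P t) := by
  unfold commonRateOfGains Real.logb
  exact (Real.measurable_log.comp ((Measurable.iInf fun k =>
    measurable_commonSINR v P t k).const_add 1)).div_const _

section Pointwise

variable {K : ℕ} {v : Fin K → ℝ} {P t : ℝ} {g : (Fin K → ℝ) × (Fin K → Fin K → ℝ)}

theorem commonSINR_nonneg (hv : ∀ k, 0 < v k) (ht0 : 0 < t) (ht1 : t ≤ 1) (hP : 0 < P)
    (h1 : ∀ k, 0 < g.1 k) (h2 : ∀ k j, 0 < g.2 k j) (k : Fin K) :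
    0 ≤ commonSINR v P t g.1 g.2 k := by
  have := sub_nonneg.2 ht1
  have := (hv k).le
  have := (h1 k).le
  have : 0 ≤ ∑ j, g.2 k j := Finset.sum_nonneg fun j _ => (h2 k j).le
  rw [commonSINR]
  positivity

theorem commonRateOfGains_nonneg (hv : ∀ k, 0 < v k) (ht0 : 0 < t) (ht1 : t ≤ 1) (hP : 0 < P)
    (h1 : ∀ k, 0 < g.1 k) (h2 : ∀ k j, 0 < g.2 k j) : 0 ≤ commonRateOfGains v P t g := by
  refine Real.logb_nonneg one_lt_two ?_
  have := Real.iInf_nonneg (commonSINR_nonneg hv ht0 ht1 hP h1 h2)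
  linarith

/-- Dropping the interference and using `log (1 + x) ≤ x` gives an integrable majorant. -/
theorem commonRateOfGains_le (hv : ∀ k, 0 < v k) (ht0 : 0 < t) (ht1 : t ≤ 1) (hP : 0 < P)
    (h1 : ∀ k, 0 < g.1 k) (h2 : ∀ k j, 0 < g.2 k j) (k : Fin K) :
    commonRateOfGains v P t g ≤ P * (1 - t) * v k / Real.log 2 * g.1 k := by
  have hnn := Real.iInf_nonneg (commonSINR_nonneg hv ht0 ht1 hP h1 h2)
  have hle : ⨅ k, commonSINR v P t g.1 g.2 k ≤ P * (1 - t) * v k * g.1 k := by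
    refine (ciInf_le (Set.finite_range _).bddBelow k).trans ?_
    have := sub_nonneg.2 ht1
    have := (hv k).le
    have := (h1 k).le
    have : 0 ≤ ∑ j, g.2 k j := Finset.sum_nonneg fun j _ => (h2 k j).le
    rw [commonSINR]
    refine div_le_self (by positivity) ?_
    have : 0 ≤ P * t / K * v k * ∑ j, g.2 k j := by positivity
    linarith
  have hlog := Real.log_le_sub_one_of_pos (by linarith : 0 < 1 + ⨅ k, commonSINR v P t g.1 g.2 k)
  rw [commonRateOfGains, Real.logb, div_mul_eq_mul_div]
  exact div_le_div_of_nonneg_right (by linarith) (Real.log_pos one_lt_two).le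

/-- At finite power, the SINR of every user is at least its high-power limit up to a factor whose
logarithm is of order `(P * t)⁻¹`. -/
theorem mul_exp_le_commonSINR (hv : ∀ k, 0 < v k) (ht0 : 0 < t) (ht1 : t ≤ 1) (hP : 0 < P)
    (h1 : ∀ k, 0 < g.1 k) (h2 : ∀ k j, 0 < g.2 k j) (k : Fin K) :
    (1 - t) / t * Real.exp (Real.log K + Real.log (minGainRatio g)
        - (P * t)⁻¹ * ∑ k, K / v k * (∑ j, g.2 k j)⁻¹) ≤ commonSINR v P t g.1 g.2 k := by
  have : Nonempty (Fin K) := ⟨k⟩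
  have hK : (0 : ℝ) < K := Nat.cast_pos.2 (Fin.pos k)
  have hS : ∀ k, 0 < ∑ j, g.2 k j := fun k =>
    Finset.sum_pos (fun j _ => h2 k j) Finset.univ_nonempty
  have hZ := minGainRatio_pos h1 h2
  have hvk := hv k
  have hSk := hS k
  have hak := h1 k
  -- Summing over all users makes the correction independent of `k`, so that it passes through the
  -- minimum.
  have hterm : K / v k * (∑ j, g.2 k j)⁻¹ ≤ ∑ k, K / v k * (∑ j, g.2 k j)⁻¹ :=
    Finset.single_le_sum (f := fun k => K / v k * (∑ j, g.2 k j)⁻¹)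
      (fun i _ => by have := hv i; have := hS i; positivity) (Finset.mem_univ k)
  have hr : 0 ≤ (1 - t) / t := div_nonneg (sub_nonneg.2 ht1) ht0.le
  set S := ∑ j, g.2 k j with hSdef
  set x := (P * t)⁻¹ * (K / v k * S⁻¹) with hx
  have hx0 : 0 < x := by positivity
  have hsinr : commonSINR v P t g.1 g.2 k = (1 - t) / t * (K * (g.1 k / S) * (x + 1)⁻¹) := by
    rw [commonSINR, ← hSdef, hx]
    field_simp
  rw [hsinr]
  refine mul_le_mul_of_nonneg_left ?_ hr
  rw [Real.exp_sub, Real.exp_add, Real.exp_log hK, Real.exp_log hZ, div_eq_mul_inv]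
  refine mul_le_mul (mul_le_mul_of_nonneg_left ?_ hK.le) (inv_anti₀ (by positivity) ?_)
    (by positivity) (by positivity)
  · exact ciInf_le (Set.finite_range _).bddBelow k
  -- The noise factor `(x + 1)⁻¹` is at least `e^{-x}`.
  · refine (Real.add_one_le_exp x).trans (Real.exp_le_exp.2 ?_)
    exact mul_le_mul_of_nonneg_left hterm (by positivity)

theorem tangent_le_commonRateOfGains (hK : 0 < K) (hv : ∀ k, 0 < v k) (ht0 : 0 < t)
    (ht1 : t ≤ 1) (hP : 0 < P) (h1 : ∀ k, 0 < g.1 k) (h2 : ∀ k j, 0 < g.2 k j)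
    {ρ : ℝ} (hρ : 0 < ρ) :
    Real.logb 2 (1 + (1 - t) / t * ρ)
      + (1 - t) / t * ρ / (1 + (1 - t) / t * ρ) / Real.log 2
        * (Real.log K + Real.log (minGainRatio g)
          - (P * t)⁻¹ * ∑ k, K / v k * (∑ j, g.2 k j)⁻¹ - Real.log ρ)
      ≤ commonRateOfGains v P t g := by
  have : Nonempty (Fin K) := ⟨⟨0, hK⟩⟩
  have hr : 0 ≤ (1 - t) / t := div_nonneg (sub_nonneg.2 ht1) ht0.le
  set x := Real.log K + Real.log (minGainRatio g)
    - (P * t)⁻¹ * ∑ k, K / v k * (∑ j, g.2 k j)⁻¹ with hx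
  have h := log_one_add_mul_exp_ge ((1 - t) / t) x (Real.log ρ) hr
  rw [Real.exp_log hρ] at h
  have hinf : (1 - t) / t * Real.exp x ≤ ⨅ k, commonSINR v P t g.1 g.2 k :=
    le_ciInf fun k => mul_exp_le_commonSINR hv ht0 ht1 hP h1 h2 k
  have h3 : Real.log (1 + (1 - t) / t * Real.exp x)
      ≤ Real.log (1 + ⨅ k, commonSINR v P t g.1 g.2 k) :=
    Real.log_le_log (by positivity) (by linarith)
  have h4 := div_le_div_of_nonneg_right (h.trans h3) (Real.log_pos one_lt_two).le
  rwa [add_div, mul_div_right_comm] at h4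

end Pointwise

/-! ### The constant `ρ` and the final bound. -/

theorem rhoMrt_pos {N K : ℕ} (hN : 1 ≤ N) (hNK : N < K) : 0 < rhoMrt N K := by
  have h1 : (1 : ℝ) ≤ N := by exact_mod_cast hN
  have h2 : (2 : ℝ) ≤ K := by exact_mod_cast (by omega : 2 ≤ K)
  have : 0 < ((N : ℝ) + K - 1) * K - 1 := by nlinarith
  rw [rhoMrt]
  positivity

theorem log_rhoMrt_lt {N K n : ℕ} (hN : 1 ≤ N) (hNK : N < K) (hn : (N + K - 1) * K = n + 1) :
    Real.log (rhoMrt N K) < Real.log K - harmonic n := by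
  have hn1 : 1 ≤ n := by
    have h1 : 2 ≤ N + K - 1 := by omega
    have h2 : 2 ≤ K := by omega
    have := Nat.mul_le_mul h1 h2
    omega
  have hcast : ((N : ℝ) + K - 1) * K - 1 = n := by
    have h : (((N + K - 1 : ℕ) : ℝ)) * K = n + 1 := by exact_mod_cast hn
    rw [Nat.cast_sub (by omega)] at h
    push_cast at h
    linarith
  have hn0 : (0 : ℝ) < n := by exact_mod_cast hn1
  have hK0 : (0 : ℝ) < K := by exact_mod_cast (by omega : 0 < K)
  have h := harmonic_lt_log_add_eulerMascheroniConstant hn1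
  rw [rhoMrt, hcast, Real.log_mul (by positivity) (Real.exp_ne_zero _),
    Real.log_div hK0.ne' hn0.ne', Real.log_exp]
  linarith

theorem sum_mrtGain_exponents {N K : ℕ} (k : Fin K) :
    ∑ j : Fin K, (if j = k then N else 1) = N + K - 1 := by
  have hK := Fin.pos k
  rw [← Finset.add_sum_erase _ _ (Finset.mem_univ k), if_pos rfl,
    Finset.sum_congr rfl (fun j hj => if_neg (Finset.ne_of_mem_erase hj))]
  simp
  omega

theorem proposition4 {N K : ℕ} (hN : 1 ≤ N) (hNK : N < K)
    {Ω : Type*} [MeasurableSpace Ω] (μ : Measure Ω) [IsProbabilityMeasure μ]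
    (h : Fin K → Ω → EuclideanSpace ℂ (Fin N)) (hh : IsRayleighChannel μ h)
    (pc : Ω → EuclideanSpace ℂ (Fin N)) (hpc : AEMeasurable pc μ)
    (hpc_norm : ∀ᵐ ω ∂μ, ‖pc ω‖ = 1)
    (v : Fin K → ℝ) (hv : ∀ k, 0 < v k ∧ v k ≤ 1) :
    ∃ s₀ : ℝ, 0 < s₀ ∧ ∀ P t : ℝ, 0 < t → t ≤ 1 → s₀ ≤ P * t →
      Integrable (commonRateOfGains v P t) (decoupledMrtGainLaw μ h pc) ∧
      Real.logb 2 (1 - rhoMrt N K + rhoMrt N K / t) ≤ approxMrtCommonRate μ h pc v P t := by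
  have hK : 0 < K := by omega
  have : Nonempty (Fin K) := ⟨⟨0, hK⟩⟩
  have := isProbabilityMeasure_expMeasure (r := 1) one_pos
  have : ∀ k j, IsProbabilityMeasure (mrtPrivateGainLaw μ h k j) := fun k j =>
    Measure.isProbabilityMeasure_map (hh.aemeasurable_privateGain k j)
  have hpos := hh.ae_pos_mrtPrivateGainLaw hN
  have hlap := fun (k j : Fin K) (y : ℝ) (hy : 0 ≤ y) =>
    hh.integral_exp_neg_mul_mrtPrivateGainLaw hN k j hy
  obtain ⟨n, hn⟩ : ∃ n, (N + K - 1) * K = n + 1 :=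
    Nat.exists_eq_succ_of_ne_zero (Nat.mul_pos (by omega) hK).ne'
  have hsum : ∑ k : Fin K, ∑ j : Fin K, (if j = k then N else 1) = n + 1 := by
    simp_rw [sum_mrtGain_exponents]
    rw [← hn]
    simp [mul_comm]
  have hlaw : decoupledMrtGainLaw μ h pc = (Measure.pi fun _ : Fin K => expMeasure 1).prod
      (Measure.pi fun k => Measure.pi fun j => mrtPrivateGainLaw μ h k j) := by
    rw [decoupledMrtGainLaw]
    simp_rw [hh.decoupledCommonGainLaw_eq hpc hpc_norm]
  have hae := ae_pos_gainLaw hpos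
  have hlogint := integrable_log_minGainRatio hpos hlap hsum
  have hlogval := integral_log_minGainRatio hpos hlap hsum
  have hinv := fun k : Fin K => integrable_inv_sum_gainLaw hpos hlap (k := k)
    ((by omega : 2 ≤ N + K - 1).trans_eq (sum_mrtGain_exponents k).symm)
  have hcommon := fun k : Fin K => integrable_commonGain_gainLaw
    (β := fun k j => mrtPrivateGainLaw μ h k j) k
  simp_rw [approxMrtCommonRate, hlaw]
  set Q := (Measure.pi fun _ : Fin K => expMeasure 1).prod
      (Measure.pi fun k => Measure.pi fun j => mrtPrivateGainLaw μ h k j) with hQ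
  have hW : Integrable (fun g : (Fin K → ℝ) × (Fin K → Fin K → ℝ) =>
      ∑ k, K / v k * (∑ j, g.2 k j)⁻¹) Q :=
    integrable_finsetSum _ fun k _ => (hinv k).const_mul _
  set C := ∫ g, ∑ k, K / v k * (∑ j, g.2 k j)⁻¹ ∂Q with hC
  have hρ := rhoMrt_pos hN hNK
  set ρ := rhoMrt N K with hρdef
  have hgap : 0 < Real.log K - harmonic n - Real.log ρ := by
    have := log_rhoMrt_lt hN hNK hn
    linarith
  set δ := Real.log K - harmonic n - Real.log ρ with hδ
  -- `C / δ` makes the expected noise loss `C / (P t)` at most the gap `δ`; the `1` keeps the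
  -- threshold positive.
  refine ⟨max 1 (C / δ), by positivity, fun P t ht0 ht1 hs => ?_⟩
  have hs1 : 0 < P * t := one_pos.trans_le ((le_max_left _ _).trans hs)
  have hP : 0 < P := pos_of_mul_pos_left hs1 ht0.le
  have hCs : (P * t)⁻¹ * C ≤ δ := by
    have := (le_max_right _ _).trans hs
    rw [inv_mul_le_iff₀ hs1]
    rwa [div_le_iff₀ hgap] at this
  have hr : 0 ≤ (1 - t) / t := div_nonneg (sub_nonneg.2 ht1) ht0.le
  have hrate : Integrable (commonRateOfGains v P t) Q := by
    refine ((hcommon ⟨0, hK⟩).const_mul (P * (1 - t) * v ⟨0, hK⟩ / Real.log 2)).mono'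
      (measurable_commonRateOfGains v P t).aestronglyMeasurable ?_
    filter_upwards [hae] with g hg
    rw [Real.norm_of_nonneg
      (commonRateOfGains_nonneg (fun k => (hv k).1) ht0 ht1 hP hg.1 hg.2)]
    exact commonRateOfGains_le (fun k => (hv k).1) ht0 ht1 hP hg.1 hg.2 _
  refine ⟨hrate, ?_⟩
  have hA : Integrable (fun g => Real.log K + Real.log (minGainRatio g)) Q :=
    (integrable_const _).add hlogint
  have hB : Integrable (fun g : (Fin K → ℝ) × (Fin K → Fin K → ℝ) =>
      Real.log K + Real.log (minGainRatio g)
        - (P * t)⁻¹ * ∑ k, K / v k * (∑ j, g.2 k j)⁻¹) Q := hA.sub (hW.const_mul _)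
  have hx : Integrable (fun g : (Fin K → ℝ) × (Fin K → Fin K → ℝ) =>
      Real.log K + Real.log (minGainRatio g)
        - (P * t)⁻¹ * ∑ k, K / v k * (∑ j, g.2 k j)⁻¹ - Real.log ρ) Q :=
    hB.sub (integrable_const _)
  have hxval : ∫ g, (Real.log K + Real.log (minGainRatio g)
        - (P * t)⁻¹ * ∑ k, K / v k * (∑ j, g.2 k j)⁻¹ - Real.log ρ) ∂Q = δ - (P * t)⁻¹ * C := by
    rw [integral_sub hB (integrable_const _), integral_sub hA (hW.const_mul _),
      integral_add (integrable_const _) hlogint, hlogval, integral_const_mul, ← hC]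
    simp only [integral_const, probReal_univ, one_smul]
    rw [hδ]
    ring
  set c := (1 - t) / t * ρ / (1 + (1 - t) / t * ρ) / Real.log 2 with hc
  have hc0 : 0 ≤ c := by
    have := Real.log_pos one_lt_two
    positivity
  -- Integrating the tangent bound leaves the value at `ρ` plus `c * (δ - C / (P t))`, which is
  -- nonnegative.
  calc Real.logb 2 (1 - ρ + ρ / t) = Real.logb 2 (1 + (1 - t) / t * ρ) := by
        congr 1
        field_simp
        ring
    _ ≤ Real.logb 2 (1 + (1 - t) / t * ρ) + c * (δ - (P * t)⁻¹ * C) :=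
        le_add_of_nonneg_right (mul_nonneg hc0 (sub_nonneg.2 hCs))
    _ = ∫ g, (Real.logb 2 (1 + (1 - t) / t * ρ) + c * (Real.log K + Real.log (minGainRatio g)
        - (P * t)⁻¹ * ∑ k, K / v k * (∑ j, g.2 k j)⁻¹ - Real.log ρ)) ∂Q := by
        rw [integral_add (integrable_const _) (hx.const_mul c), integral_const_mul, hxval]
        simp
    _ ≤ ∫ g, commonRateOfGains v P t g ∂Q := by
        refine integral_mono_ae ((integrable_const _).add (hx.const_mul c)) hrate ?_
        filter_upwards [hae] with g hg
        exact tangent_le_commonRateOfGains hK (fun k => (hv k).1) ht0 ht1 hP hg.1 hg.2 hρ
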